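/- Let $m \ge 3$ be an integer and let $P$ be the uniform distribution (normalized arc length) on the boundary of a regular $m$-sided polygon inscribed in a circle of radius $1$ in the plane $\mathbb{R}^2$. For $n \in \mathbb{N}$, $n \ge 1$, let $$V_n(P) = \inf\Big\{ \int \min_{a \in \alpha} \|x-a\|^2 \, dP(x) \;:\; \alpha \subset \mathbb{R}^2,\ 1 \le \operatorname{card}(\alpha) \le n \Big\}$$ be the $n$th quantization error of $P$, where $\|\cdot\|$ is the Euclidean norm. Then the (one-dimensional) quantization coefficient $\lim_{n\to\infty} n^2 V_n(P)$ of $P$ exists as a finite positive number, and $$\lim_{n\to\infty} n^2 V_n(P) = \frac{1}{3}\, m^2 \sin^2\Big(\frac{\pi}{m}\Big).$$ -/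

import Mathlib

open Filter Topology MeasureTheory
open scoped ENNReal

/-- The distortion error `V(P; α) = ∫ min_{a ∈ α} ‖x - a‖² dP(x)` of a measure `P` with respect to a
finite set `α`, as an element of `[0, ∞]`. -/
noncomputable def distortion {E : Type*} [NormedAddCommGroup E] [MeasurableSpace E]
    (P : Measure E) (α : Finset E) : ℝ≥0∞ :=
  ∫⁻ x, ⨅ a ∈ α, ENNReal.ofReal (‖x - a‖ ^ 2) ∂P

/-- The `n`th quantization error `V_n(P)`: the infimum of `V(P; α)` over all sets `α` with at least
one and at most `n` points. -/
noncomputable def quantizationError {E : Type*} [NormedAddCommGroup E] [MeasurableSpace E]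
    (P : Measure E) (n : ℕ) : ℝ≥0∞ :=
  ⨅ (α : Finset E) (_ : 1 ≤ α.card ∧ α.card ≤ n), distortion P α

/-- The vertices, in counterclockwise order, of the regular `m`-gon inscribed in the circle of
radius one about `c`, where the vertex of index `0` has polar angle `θ` as seen from `c`. -/
noncomputable def polygonVertex (m : ℕ) (c : EuclideanSpace ℝ (Fin 2)) (θ : ℝ) (j : ℕ) :
    EuclideanSpace ℝ (Fin 2) :=
  c + !₂[Real.cos (θ + 2 * Real.pi * j / m), Real.sin (θ + 2 * Real.pi * j / m)]

/-- The boundary of that polygon: the union of its `m` sides (vertex `m` is vertex `0`). -/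
noncomputable def polygonBoundary (m : ℕ) (c : EuclideanSpace ℝ (Fin 2)) (θ : ℝ) :
    Set (EuclideanSpace ℝ (Fin 2)) :=
  ⋃ j ∈ Finset.range m, segment ℝ (polygonVertex m c θ j) (polygonVertex m c θ (j + 1))

/-- The uniform distribution on the boundary of the polygon: arc length (one-dimensional Hausdorff
measure) restricted to the boundary and divided by the total length of the boundary. -/
noncomputable def polygonUniform (m : ℕ) (c : EuclideanSpace ℝ (Fin 2)) (θ : ℝ) :
    Measure (EuclideanSpace ℝ (Fin 2)) :=
  ProbabilityTheory.cond (Measure.hausdorffMeasure 1) (polygonBoundary m c θ)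

/-!
The arc length measure on the boundary has total mass `L = 2 m h`, where `h = sin (π / m)`, and the
limit is `L ^ 2 / 12`, the value for a segment of length `L`: up to lower order the corners play no
role.

Upper bound (`quantizationError_polygonUniform_le`): place `k = ⌊n / m⌋` points at the midpoints of
`k` equal cells on each side. This gives `V_n ≤ h ^ 2 / (3 k ^ 2)`, and `n / k → m`.

Lower bound (`le_quantizationError_polygonUniform`): for a code `α` of at most `n` points and any
`R ≥ 0`,
`R ^ 2 ≤ min_{a ∈ α} ‖x - a‖ ^ 2 + ∑_{a ∈ α} (R ^ 2 - ‖x - a‖ ^ 2)⁺`.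
Along a straight line each term of the sum has integral at most `4 R ^ 3 / 3`, the value for a point
on the line. Trim every side to arc length parameters `|t| ≤ s` with `s < h`. Trimmed sides have
mutual distance at least `sideGap m s > 0`, since each stays strictly below the supporting lines of
the other sides; so once `2 R ≤ sideGap m s` each `a` sees at most one of them
(`sum_setLIntegral_ofReal_sq_sub_norm_sq_le`). Integrating over the trimmed sides, the squared
distances contribute at least `2 m s R ^ 2 - 4 n R ^ 3 / 3`, and the choice `R = s m / n` yields
`n ^ 2 V_n ≥ s ^ 3 m ^ 2 / (3 h)` for all large `n`. Finally `s → h`.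
-/

/-! ### Integration over finite unions -/

theorem lintegral_biUnion_finset_le {X ι : Type*} [MeasurableSpace X] (μ : Measure X) (T : Finset ι)
    (s : ι → Set X) (f : X → ℝ≥0∞) :
    ∫⁻ x in ⋃ i ∈ T, s i, f x ∂μ ≤ ∑ i ∈ T, ∫⁻ x in s i, f x ∂μ := by
  classical
  induction T using Finset.induction_on with
  | empty => simp
  | insert i T hi ih =>
    rw [Finset.set_biUnion_insert, Finset.sum_insert hi]
    exact (lintegral_union_le _ _ _).trans (by gcongr)

/-! ### Integrals of squared distances on the real line -/

theorem lintegral_Icc_sub_sq (τ ρ : ℝ) (hρ : 0 ≤ ρ) :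
    ∫⁻ t in Set.Icc (τ - ρ) (τ + ρ), ENNReal.ofReal ((t - τ) ^ 2)
      = ENNReal.ofReal (2 / 3 * ρ ^ 3) := by
  rw [← ofReal_integral_eq_lintegral_ofReal]
  · congr 1
    rw [integral_Icc_eq_integral_Ioc, ← intervalIntegral.integral_of_le (by linarith),
      intervalIntegral.integral_comp_sub_right (fun t => t ^ 2) τ, integral_pow]
    ring
  · exact ContinuousOn.integrableOn_Icc (by fun_prop)
  · exact Eventually.of_forall fun t => sq_nonneg _

theorem lintegral_ofReal_sq_sub_sq (τ R : ℝ) (hR : 0 ≤ R) :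
    ∫⁻ t, ENNReal.ofReal (R ^ 2 - (t - τ) ^ 2) = ENNReal.ofReal (4 / 3 * R ^ 3) := by
  have hsupp : ∀ t ∉ Set.Icc (τ - R) (τ + R), ENNReal.ofReal (R ^ 2 - (t - τ) ^ 2) = 0 := by
    intro t ht
    rw [ENNReal.ofReal_eq_zero]
    by_contra! h
    have := abs_le.mp (abs_le_of_sq_le_sq (by linarith : (t - τ) ^ 2 ≤ R ^ 2) hR)
    exact ht ⟨by linarith, by linarith⟩
  rw [← Set.indicator_eq_self.mpr (Function.support_subset_iff'.mpr hsupp),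
    lintegral_indicator measurableSet_Icc, ← ofReal_integral_eq_lintegral_ofReal]
  · congr 1
    rw [integral_Icc_eq_integral_Ioc, ← intervalIntegral.integral_of_le (by linarith),
      intervalIntegral.integral_comp_sub_right (fun t => R ^ 2 - t ^ 2) τ,
      intervalIntegral.integral_sub (by simp) (by simp), integral_pow]
    simp
    ring
  · exact ContinuousOn.integrableOn_Icc (by fun_prop)
  · refine (ae_restrict_iff' measurableSet_Icc).mpr (Eventually.of_forall fun t ht => ?_)
    have := sq_le_sq' (by linarith [ht.1]) (by linarith [ht.2] : t - τ ≤ R)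
    simp only [Pi.zero_apply]
    linarith

/-- Cutting `[-h, h]` into `k` equal cells and taking their midpoints as code points. -/
theorem lintegral_iInf_midpoints_le (h : ℝ) (hh : 0 ≤ h) (k : ℕ) (hk : 0 < k) :
    ∫⁻ t in Set.Icc (-h) h,
        ⨅ i ∈ Finset.range k, ENNReal.ofReal ((t - (-h + (2 * i + 1) * h / k)) ^ 2)
      ≤ ENNReal.ofReal (2 / 3 * h ^ 3 / k ^ 2) := by
  have hk' : (0 : ℝ) < k := by exact_mod_cast hk
  set τ : ℕ → ℝ := fun i => -h + (2 * i + 1) * h / k with hτ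
  have hcover : Set.Icc (-h) h ⊆ ⋃ i ∈ Finset.range k, Set.Icc (τ i - h / k) (τ i + h / k) := by
    intro t ht
    rcases hh.eq_or_lt with rfl | hpos
    · simp only [Set.mem_iUnion]
      exact ⟨0, Finset.mem_range.mpr hk, by simpa [hτ] using ht⟩
    -- the cell index is `⌊(t + h) k / (2 h)⌋`, except at the right end point `t = h`
    rcases ht.2.eq_or_lt with rfl | hlt
    · simp only [Set.mem_iUnion]
      refine ⟨k - 1, Finset.mem_range.mpr (by omega), ?_⟩
      have h1 : τ (k - 1) = t - t / k := by
        simp only [hτ]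
        rw [Nat.cast_pred hk]
        field_simp
        ring
      have : 0 < t / k := by positivity
      rw [h1]
      constructor <;> linarith
    · set y := (t + h) * k / (2 * h) with hy
      have hy0 : 0 ≤ y := div_nonneg (mul_nonneg (by linarith [ht.1]) hk'.le) (by linarith)
      have hyk : y < k := by
        rw [hy, div_lt_iff₀ (by linarith)]
        nlinarith
      have htey : t = -h + 2 * h / k * y := by
        rw [hy]; field_simp; ring
      have h1 := Nat.floor_le hy0
      have h2 := Nat.lt_floor_add_one y
      simp only [Set.mem_iUnion]
      refine ⟨⌊y⌋₊, Finset.mem_range.mpr ((Nat.floor_lt hy0).mpr hyk), ?_⟩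
      have e1 : τ ⌊y⌋₊ - h / k = -h + 2 * h / k * ⌊y⌋₊ := by simp only [hτ]; ring
      have e2 : τ ⌊y⌋₊ + h / k = -h + 2 * h / k * (⌊y⌋₊ + 1) := by simp only [hτ]; ring
      have : 0 < 2 * h / k := by positivity
      rw [e1, e2]
      constructor <;> nlinarith
  calc _ ≤ ∫⁻ t in ⋃ i ∈ Finset.range k, Set.Icc (τ i - h / k) (τ i + h / k),
          ⨅ i ∈ Finset.range k, ENNReal.ofReal ((t - τ i) ^ 2) := lintegral_mono_set hcover
    _ ≤ ∑ i ∈ Finset.range k, ∫⁻ t in Set.Icc (τ i - h / k) (τ i + h / k),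
          ⨅ i ∈ Finset.range k, ENNReal.ofReal ((t - τ i) ^ 2) :=
        lintegral_biUnion_finset_le _ _ _ _
    _ ≤ ∑ i ∈ Finset.range k, ENNReal.ofReal (2 / 3 * (h / k) ^ 3) := by
        refine Finset.sum_le_sum fun i hi => ?_
        rw [← lintegral_Icc_sub_sq (τ i) (h / k) (by positivity)]
        exact lintegral_mono fun t => iInf₂_le i hi
    _ = ENNReal.ofReal (2 / 3 * h ^ 3 / k ^ 2) := by
        rw [Finset.sum_const, Finset.card_range, nsmul_eq_mul, ← ENNReal.ofReal_natCast,
          ← ENNReal.ofReal_mul (by positivity)]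
        congr 1
        field_simp

/-! ### Straight lines with unit speed -/

section Line

variable {E : Type*} [NormedAddCommGroup E] [InnerProductSpace ℝ E]

theorem isometry_add_smul_of_norm_eq_one (p : E) {w : E} (hw : ‖w‖ = 1) :
    Isometry fun t : ℝ => p + t • w := by
  refine Isometry.of_dist_eq fun s t => ?_
  rw [dist_add_left, dist_eq_norm, ← sub_smul, norm_smul, hw, mul_one, Real.dist_eq,
    Real.norm_eq_abs]

/-- A point is at least as far from a point of a line as its orthogonal projection is. -/
theorem sq_sub_inner_le_norm_sq (p a : E) {w : E} (hw : ‖w‖ = 1) (t : ℝ) :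
    (t - inner ℝ w (a - p)) ^ 2 ≤ ‖p + t • w - a‖ ^ 2 := by
  have h : inner ℝ w (p + t • w - a) = t - inner ℝ w (a - p) := by
    simp only [inner_sub_right, inner_add_right, inner_smul_right, real_inner_self_eq_norm_sq, hw]
    ring
  rw [← h, sq_le_sq, abs_norm]
  simpa [hw] using abs_real_inner_le_norm w (p + t • w - a)

theorem lintegral_ofReal_sq_sub_norm_sq_le (p a : E) {w : E} (hw : ‖w‖ = 1) (R : ℝ) (hR : 0 ≤ R) :
    ∫⁻ t : ℝ, ENNReal.ofReal (R ^ 2 - ‖p + t • w - a‖ ^ 2) ≤ ENNReal.ofReal (4 / 3 * R ^ 3) := by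
  rw [← lintegral_ofReal_sq_sub_sq (inner ℝ w (a - p)) R hR]
  exact lintegral_mono fun t =>
    ENNReal.ofReal_le_ofReal (by linarith [sq_sub_inner_le_norm_sq p a hw t])

end Line

/-- Integration with respect to arc length along an isometrically parametrized curve. -/
theorem Isometry.setLIntegral_hausdorffMeasure_image {E : Type*} [MetricSpace E]
    [MeasurableSpace E] [BorelSpace E] {γ : ℝ → E} (hγ : Isometry γ) (s : Set ℝ) (f : E → ℝ≥0∞) :
    ∫⁻ x in γ '' s, f x ∂(Measure.hausdorffMeasure 1) = ∫⁻ t in s, f (γ t) := by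
  have hemb : MeasurableEmbedding γ := hγ.isClosedEmbedding.measurableEmbedding
  have : (Measure.hausdorffMeasure 1 : Measure E).restrict (γ '' s)
      = Measure.map γ (volume.restrict s) := by
    rw [← hausdorffMeasure_real]
    conv_rhs => rw [← Set.preimage_image_eq s hγ.injective]
    rw [← hemb.restrict_map, hγ.map_hausdorffMeasure (Or.inl zero_le_one),
      Measure.restrict_restrict_of_subset (Set.image_subset_range γ s)]
  rw [this, hemb.lintegral_map]

/-! ### Lower bound for the distortion on separated line pieces -/

/-- The pointwise inequality behind the lower bound: the term of the sum that belongs to a nearest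
point of `α` already suffices. -/
theorem ofReal_sq_le_iInf_add_sum {E : Type*} [NormedAddCommGroup E] (α : Finset E)
    (hα : α.Nonempty) (R : ℝ) (x : E) :
    ENNReal.ofReal (R ^ 2) ≤ (⨅ a ∈ α, ENNReal.ofReal (‖x - a‖ ^ 2))
      + ∑ a ∈ α, ENNReal.ofReal (R ^ 2 - ‖x - a‖ ^ 2) := by
  obtain ⟨b, hb, hmin⟩ := α.exists_min_image (fun a => ENNReal.ofReal (‖x - a‖ ^ 2)) hα
  calc ENNReal.ofReal (R ^ 2) = ENNReal.ofReal (‖x - b‖ ^ 2 + (R ^ 2 - ‖x - b‖ ^ 2)) := by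
        congr 1; ring
    _ ≤ ENNReal.ofReal (‖x - b‖ ^ 2) + ENNReal.ofReal (R ^ 2 - ‖x - b‖ ^ 2) :=
        ENNReal.ofReal_add_le
    _ ≤ _ := add_le_add (le_iInf₂ hmin)
        (Finset.single_le_sum (f := fun a => ENNReal.ofReal (R ^ 2 - ‖x - a‖ ^ 2))
          (fun _ _ => zero_le) hb)

section Separated

variable {E ι : Type*} [NormedAddCommGroup E] [InnerProductSpace ℝ E]

/-- If pieces of lines are at mutual distance at least `2 R`, the ball of radius `R` about a point
`a` meets at most one of them, so that `a` can account for one bump of size `4 R³ / 3` only. -/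
theorem sum_setLIntegral_ofReal_sq_sub_norm_sq_le (T : Finset ι) (p w : ι → E)
    (hw : ∀ j ∈ T, ‖w j‖ = 1) (S : Set ℝ) (hS : MeasurableSet S) (R : ℝ) (hR : 0 ≤ R)
    (hsep : ∀ j ∈ T, ∀ k ∈ T, j ≠ k → ∀ t ∈ S, ∀ t' ∈ S,
      2 * R ≤ ‖(p j + t • w j) - (p k + t' • w k)‖) (a : E) :
    ∑ j ∈ T, ∫⁻ t in S, ENNReal.ofReal (R ^ 2 - ‖p j + t • w j - a‖ ^ 2)
      ≤ ENNReal.ofReal (4 / 3 * R ^ 3) := by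
  have hzero : ∀ j, (∀ t ∈ S, R ≤ ‖p j + t • w j - a‖) →
      ∫⁻ t in S, ENNReal.ofReal (R ^ 2 - ‖p j + t • w j - a‖ ^ 2) = 0 := by
    intro j hj
    rw [setLIntegral_congr_fun hS (g := fun _ => 0), lintegral_zero]
    intro t ht
    exact ENNReal.ofReal_eq_zero.mpr (by nlinarith [hj t ht])
  by_cases h : ∃ j ∈ T, ∃ t ∈ S, ‖p j + t • w j - a‖ < R
  · obtain ⟨j, hj, t, ht, hta⟩ := h
    rw [Finset.sum_eq_single_of_mem j hj]
    · exact (setLIntegral_le_lintegral _ _).trans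
        (lintegral_ofReal_sq_sub_norm_sq_le (p j) a (hw j hj) R hR)
    · intro k hk hkj
      refine hzero k fun t' ht' => ?_
      have h1 := hsep j hj k hk hkj.symm t ht t' ht'
      have h2 := norm_sub_le (p j + t • w j - a) (p k + t' • w k - a)
      rw [sub_sub_sub_cancel_right] at h2
      linarith
  · push Not at h
    rw [Finset.sum_eq_zero fun j hj => hzero j (h j hj)]
    exact zero_le

/-- `n` points leave at least `R² ℓ - 4 n R³ / 3` of squared distance on separated pieces of lines
of total length `ℓ`. -/
theorem card_mul_volume_mul_le_sum_setLIntegral_add (T : Finset ι) (p w : ι → E)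
    (hw : ∀ j ∈ T, ‖w j‖ = 1) (S : Set ℝ) (hS : MeasurableSet S) (R : ℝ) (hR : 0 ≤ R)
    (hsep : ∀ j ∈ T, ∀ k ∈ T, j ≠ k → ∀ t ∈ S, ∀ t' ∈ S,
      2 * R ≤ ‖(p j + t • w j) - (p k + t' • w k)‖) (α : Finset E) (hα : α.Nonempty) :
    T.card * (ENNReal.ofReal (R ^ 2) * volume S) ≤
      (∑ j ∈ T, ∫⁻ t in S, ⨅ a ∈ α, ENNReal.ofReal (‖p j + t • w j - a‖ ^ 2))
        + α.card * ENNReal.ofReal (4 / 3 * R ^ 3) := by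
  have hmeas : ∀ j a, Measurable fun t : ℝ =>
      ENNReal.ofReal (R ^ 2 - ‖p j + t • w j - a‖ ^ 2) := fun j a =>
    ENNReal.measurable_ofReal.comp (Continuous.measurable (by fun_prop))
  calc T.card * (ENNReal.ofReal (R ^ 2) * volume S)
      = ∑ j ∈ T, ∫⁻ _ in S, ENNReal.ofReal (R ^ 2) := by
        rw [setLIntegral_const, Finset.sum_const, nsmul_eq_mul]
    _ ≤ ∑ j ∈ T, ∫⁻ t in S, ((⨅ a ∈ α, ENNReal.ofReal (‖p j + t • w j - a‖ ^ 2))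
          + ∑ a ∈ α, ENNReal.ofReal (R ^ 2 - ‖p j + t • w j - a‖ ^ 2)) :=
        Finset.sum_le_sum fun j _ => lintegral_mono fun t => ofReal_sq_le_iInf_add_sum α hα R _
    _ = (∑ j ∈ T, ∫⁻ t in S, ⨅ a ∈ α, ENNReal.ofReal (‖p j + t • w j - a‖ ^ 2))
          + ∑ a ∈ α, ∑ j ∈ T,
            ∫⁻ t in S, ENNReal.ofReal (R ^ 2 - ‖p j + t • w j - a‖ ^ 2) := by
        rw [Finset.sum_comm, ← Finset.sum_add_distrib]
        refine Finset.sum_congr rfl fun j _ => ?_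
        rw [lintegral_add_right _ (Finset.measurable_sum _ fun a _ => hmeas j a),
          lintegral_finsetSum _ fun a _ => hmeas j a]
    _ ≤ _ := by
        gcongr
        rw [← nsmul_eq_mul]
        exact Finset.sum_le_card_nsmul _ _ _ fun a _ =>
          sum_setLIntegral_ofReal_sq_sub_norm_sq_le T p w hw S hS R hR hsep a

end Separated

/-! ### The sides of the polygon -/

/-- The unit vector of the plane with polar angle `β`. -/
noncomputable def unitVec (β : ℝ) : EuclideanSpace ℝ (Fin 2) := !₂[Real.cos β, Real.sin β]

theorem inner_unitVec (β β' : ℝ) : inner ℝ (unitVec β) (unitVec β') = Real.cos (β - β') := by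
  simp [unitVec, PiLp.inner_apply, Fin.sum_univ_two, Real.cos_sub]
  ring

theorem norm_unitVec (β : ℝ) : ‖unitVec β‖ = 1 := by
  have h := real_inner_self_eq_norm_sq (unitVec β)
  rw [inner_unitVec, sub_self, Real.cos_zero] at h
  exact (pow_eq_one_iff_of_nonneg (norm_nonneg _) two_ne_zero).mp h.symm

/-- The polar angle of the outer normal of the side that joins the vertices `j` and `j + 1`. -/
noncomputable def sideAngle (m : ℕ) (θ : ℝ) (j : ℕ) : ℝ := θ + (2 * j + 1) * (Real.pi / m)

/-- The midpoint of the side that joins the vertices `j` and `j + 1`. -/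
noncomputable def sideMidpoint (m : ℕ) (c : EuclideanSpace ℝ (Fin 2)) (θ : ℝ) (j : ℕ) :
    EuclideanSpace ℝ (Fin 2) :=
  c + Real.cos (Real.pi / m) • unitVec (sideAngle m θ j)

/-- The direction in which the side from vertex `j` to vertex `j + 1` is traversed. -/
noncomputable def sideDirection (m : ℕ) (θ : ℝ) (j : ℕ) : EuclideanSpace ℝ (Fin 2) :=
  unitVec (sideAngle m θ j + Real.pi / 2)

/-- The arc length parametrization of the line through the vertices `j` and `j + 1`, centred at the
midpoint of the side; the side itself is the image of `[-sin (π / m), sin (π / m)]`. -/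
noncomputable def sideLine (m : ℕ) (c : EuclideanSpace ℝ (Fin 2)) (θ : ℝ) (j : ℕ) (t : ℝ) :
    EuclideanSpace ℝ (Fin 2) :=
  sideMidpoint m c θ j + t • sideDirection m θ j

theorem isometry_sideLine (m : ℕ) (c : EuclideanSpace ℝ (Fin 2)) (θ : ℝ) (j : ℕ) :
    Isometry (sideLine m c θ j) :=
  isometry_add_smul_of_norm_eq_one _ (norm_unitVec _)

theorem sideLine_neg_sin (m : ℕ) (c : EuclideanSpace ℝ (Fin 2)) (θ : ℝ) (j : ℕ) :
    sideLine m c θ j (-Real.sin (Real.pi / m)) = polygonVertex m c θ j := by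
  have h : θ + 2 * Real.pi * j / m = sideAngle m θ j - Real.pi / m := by
    rw [sideAngle]; ring
  ext i
  fin_cases i
  · simp [sideLine, sideMidpoint, sideDirection, polygonVertex, unitVec, h, Real.cos_sub,
      Real.cos_add_pi_div_two]
    ring
  · simp [sideLine, sideMidpoint, sideDirection, polygonVertex, unitVec, h, Real.sin_sub,
      Real.sin_add_pi_div_two]
    ring

theorem sideLine_sin (m : ℕ) (c : EuclideanSpace ℝ (Fin 2)) (θ : ℝ) (j : ℕ) :
    sideLine m c θ j (Real.sin (Real.pi / m)) = polygonVertex m c θ (j + 1) := by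
  have h : θ + 2 * Real.pi * ((j : ℝ) + 1) / m = sideAngle m θ j + Real.pi / m := by
    rw [sideAngle]; ring
  ext i
  fin_cases i
  · simp [sideLine, sideMidpoint, sideDirection, polygonVertex, unitVec, h, Real.cos_add]
    ring
  · simp [sideLine, sideMidpoint, sideDirection, polygonVertex, unitVec, h, Real.sin_add]
    ring

theorem sin_pi_div_pos {m : ℕ} (hm : 3 ≤ m) : 0 < Real.sin (Real.pi / m) := by
  have hm' : (3 : ℝ) ≤ m := by exact_mod_cast hm
  exact Real.sin_pos_of_pos_of_lt_pi (by positivity)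
    (div_lt_self Real.pi_pos (by linarith))

theorem polygonBoundary_eq_biUnion_image {m : ℕ} (hm : 3 ≤ m) (c : EuclideanSpace ℝ (Fin 2))
    (θ : ℝ) :
    polygonBoundary m c θ = ⋃ j ∈ Finset.range m,
      sideLine m c θ j '' Set.Icc (-Real.sin (Real.pi / m)) (Real.sin (Real.pi / m)) := by
  rw [polygonBoundary]
  refine Set.iUnion₂_congr fun j _ => ?_
  have hline : sideLine m c θ j = AffineMap.lineMap (k := ℝ) (sideMidpoint m c θ j)
      (sideMidpoint m c θ j + sideDirection m θ j) := by
    ext1 t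
    rw [AffineMap.lineMap_apply, vsub_eq_sub, vadd_eq_add, add_sub_cancel_left, add_comm, sideLine]
  rw [← sideLine_neg_sin, ← sideLine_sin,
    ← segment_eq_Icc (by linarith [sin_pi_div_pos hm]), hline, image_segment]

/-! ### Separation of the sides away from the vertices -/

theorem cos_le_cos_of_le_of_le_two_pi_sub {a x : ℝ} (ha : 0 ≤ a) (hax : a ≤ x)
    (hx : x ≤ 2 * Real.pi - a) : Real.cos x ≤ Real.cos a := by
  rcases le_total x Real.pi with h | h
  · exact Real.cos_le_cos_of_nonneg_of_le_pi ha h hax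
  · rw [← Real.cos_two_pi_sub x]
    exact Real.cos_le_cos_of_nonneg_of_le_pi ha (by linarith) (by linarith)

/-- The heights of the two end points of one side in the direction normal to another side, the
normals being `2 i π / m` apart: both are at most `cos (π / m)`, the height of that other side, and
one of them is lower still, since two sides share at most one vertex. -/
theorem cos_endpoints_le {m : ℕ} (hm : 3 ≤ m) {i : ℕ} (hi : 0 < i) (him : i < m) :
    Real.cos (2 * i * (Real.pi / m) - Real.pi / m) ≤ Real.cos (Real.pi / m) ∧
    Real.cos (2 * i * (Real.pi / m) + Real.pi / m) ≤ Real.cos (Real.pi / m) ∧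
    (Real.cos (2 * i * (Real.pi / m) - Real.pi / m) ≤ Real.cos (3 * (Real.pi / m)) ∨
      Real.cos (2 * i * (Real.pi / m) + Real.pi / m) ≤ Real.cos (3 * (Real.pi / m))) := by
  have hm' : (3 : ℝ) ≤ m := by exact_mod_cast hm
  have h1 : (1 : ℝ) ≤ i := by exact_mod_cast hi
  have h2 : (i : ℝ) + 1 ≤ m := by exact_mod_cast him
  have hmul : (m : ℝ) * (Real.pi / m) = Real.pi := by field_simp
  set ψ := Real.pi / m
  have hψ : 0 < ψ := by positivity
  refine ⟨cos_le_cos_of_le_of_le_two_pi_sub hψ.le ?_ ?_,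
    cos_le_cos_of_le_of_le_two_pi_sub hψ.le ?_ ?_, ?_⟩
  · nlinarith
  · nlinarith
  · nlinarith
  · nlinarith
  · rcases Nat.lt_or_ge 1 i with h | h
    · have h3 : (2 : ℝ) ≤ i := by exact_mod_cast h
      left
      apply cos_le_cos_of_le_of_le_two_pi_sub <;> nlinarith
    · have h3 : (i : ℝ) = 1 := by exact_mod_cast (by omega : i = 1)
      right
      rw [h3]
      apply cos_le_cos_of_le_of_le_two_pi_sub <;> nlinarith

theorem inner_unitVec_sideLine_sub (m : ℕ) (c : EuclideanSpace ℝ (Fin 2)) (θ : ℝ) (j k : ℕ)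
    (t : ℝ) :
    inner ℝ (unitVec (sideAngle m θ j)) (sideLine m c θ k t - c)
      = Real.cos (Real.pi / m) * Real.cos (sideAngle m θ j - sideAngle m θ k)
        + t * Real.sin (sideAngle m θ j - sideAngle m θ k) := by
  have h : sideLine m c θ k t - c = Real.cos (Real.pi / m) • unitVec (sideAngle m θ k)
      + t • sideDirection m θ k := by
    rw [sideLine, sideMidpoint]; abel
  rw [h, inner_add_right, inner_smul_right, inner_smul_right, sideDirection, inner_unitVec,
    inner_unitVec, ← sub_sub, Real.cos_sub_pi_div_two]

/-- A lower bound for the distance between two different sides, both trimmed to the parameters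
`|t| ≤ s`: at least the proportion `(h - s) / (2 h)`, with `h = sin (π / m)`, of the drop in height
`cos (π / m) - cos (3 π / m)` between a vertex of a side and the next vertex off that side. -/
noncomputable def sideGap (m : ℕ) (s : ℝ) : ℝ :=
  (Real.sin (Real.pi / m) - s) / (2 * Real.sin (Real.pi / m))
    * (Real.cos (Real.pi / m) - Real.cos (3 * (Real.pi / m)))

theorem sideGap_pos {m : ℕ} (hm : 3 ≤ m) {s : ℝ} (hs : s < Real.sin (Real.pi / m)) :
    0 < sideGap m s := by
  have hm' : (3 : ℝ) ≤ m := by exact_mod_cast hm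
  have hψ : 0 < Real.pi / m := by positivity
  have h3 : 3 * (Real.pi / m) ≤ Real.pi := by
    rw [← mul_div_assoc, div_le_iff₀ (by linarith)]
    nlinarith [Real.pi_pos]
  have := Real.cos_lt_cos_of_nonneg_of_le_pi hψ.le h3 (by linarith)
  exact mul_pos (div_pos (by linarith) (by linarith [sin_pi_div_pos hm])) (by linarith)

/-- A trimmed side stays below the supporting line of every other side. -/
theorem inner_unitVec_sideLine_sub_le {m : ℕ} (hm : 3 ≤ m) (c : EuclideanSpace ℝ (Fin 2)) (θ : ℝ)
    {j k : ℕ} (hj : j < m) (hk : k < m) (hjk : j ≠ k) {s t : ℝ} (hs : s ≤ Real.sin (Real.pi / m))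
    (ht : t ∈ Set.Icc (-s) s) :
    inner ℝ (unitVec (sideAngle m θ j)) (sideLine m c θ k t - c)
      ≤ Real.cos (Real.pi / m) - sideGap m s := by
  have hpos := sin_pi_div_pos hm
  obtain ⟨d, hd⟩ : ∃ d, d = sideAngle m θ j - sideAngle m θ k := ⟨_, rfl⟩
  have key : Real.cos (d - Real.pi / m) ≤ Real.cos (Real.pi / m) ∧
      Real.cos (d + Real.pi / m) ≤ Real.cos (Real.pi / m) ∧
      (Real.cos (d - Real.pi / m) ≤ Real.cos (3 * (Real.pi / m)) ∨
        Real.cos (d + Real.pi / m) ≤ Real.cos (3 * (Real.pi / m))) := by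
    rcases lt_or_gt_of_ne hjk with h | h
    · obtain ⟨h1, h2, h3⟩ := cos_endpoints_le hm (Nat.sub_pos_of_lt h) (by omega : k - j < m)
      have e : d = -(2 * ((k - j : ℕ) : ℝ) * (Real.pi / m)) := by
        rw [hd, sideAngle, sideAngle, Nat.cast_sub h.le]; ring
      rw [e, ← neg_add', Real.cos_neg, neg_add_eq_sub, ← neg_sub, Real.cos_neg]
      exact ⟨h2, h1, h3.symm⟩
    · have e : d = 2 * ((j - k : ℕ) : ℝ) * (Real.pi / m) := by
        rw [hd, sideAngle, sideAngle, Nat.cast_sub h.le]; ring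
      rw [e]
      exact cos_endpoints_le hm (Nat.sub_pos_of_lt h) (by omega)
  rw [inner_unitVec_sideLine_sub, ← hd, sideGap]
  set h := Real.sin (Real.pi / m)
  -- the point is the convex combination of the end points with weights `(h + t) / (2 h)` and
  -- `(h - t) / (2 h)`, neither of which is less than `(h - s) / (2 h)`
  have hconv : Real.cos (Real.pi / m) * Real.cos d + t * Real.sin d
      = (h + t) / (2 * h) * Real.cos (d - Real.pi / m)
        + (h - t) / (2 * h) * Real.cos (d + Real.pi / m) := by
    rw [Real.cos_sub, Real.cos_add]
    change _ = (h + t) / (2 * h) * (_ + _ * h) + (h - t) / (2 * h) * (_ - _ * h)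
    field_simp
    ring
  rw [hconv]
  have hsum : (h + t) / (2 * h) + (h - t) / (2 * h) = 1 := by field_simp; ring
  have hw1 : (h - s) / (2 * h) ≤ (h + t) / (2 * h) := by gcongr; linarith [ht.1]
  have hw2 : (h - s) / (2 * h) ≤ (h - t) / (2 * h) := by gcongr; linarith [ht.2]
  have hw0 : 0 ≤ (h - s) / (2 * h) := div_nonneg (by linarith) (by linarith)
  generalize (h + t) / (2 * h) = x at *
  generalize (h - t) / (2 * h) = y at *
  generalize (h - s) / (2 * h) = z at *
  generalize Real.cos (d - Real.pi / m) = A at *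
  generalize Real.cos (d + Real.pi / m) = B at *
  have hC3 : Real.cos (3 * (Real.pi / m)) ≤ Real.cos (Real.pi / m) := by
    have hgap := sideGap_pos hm (s := 0) hpos
    exact (sub_pos.mp ((mul_pos_iff_of_pos_left (by rw [sub_zero]; positivity)).mp hgap)).le
  generalize Real.cos (Real.pi / m) = C at *
  generalize Real.cos (3 * (Real.pi / m)) = D at *
  obtain ⟨k1, k2, k3⟩ := key
  obtain rfl : y = 1 - x := by linarith
  rcases k3 with k3 | k3
  · have h1 : x * A ≤ x * D := mul_le_mul_of_nonneg_left k3 (by linarith)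
    have h2 : (1 - x) * B ≤ (1 - x) * C := mul_le_mul_of_nonneg_left k2 (by linarith)
    have h3 : z * (C - D) ≤ x * (C - D) := mul_le_mul_of_nonneg_right hw1 (by linarith)
    linarith
  · have h1 : x * A ≤ x * C := mul_le_mul_of_nonneg_left k1 (by linarith)
    have h2 : (1 - x) * B ≤ (1 - x) * D := mul_le_mul_of_nonneg_left k3 (by linarith)
    have h3 : z * (C - D) ≤ (1 - x) * (C - D) := mul_le_mul_of_nonneg_right hw2 (by linarith)
    linarith

theorem sideGap_le_norm_sideLine_sub {m : ℕ} (hm : 3 ≤ m) (c : EuclideanSpace ℝ (Fin 2)) (θ : ℝ)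
    {j k : ℕ} (hj : j < m) (hk : k < m) (hjk : j ≠ k) {s t t' : ℝ}
    (hs : s ≤ Real.sin (Real.pi / m)) (ht' : t' ∈ Set.Icc (-s) s) :
    sideGap m s ≤ ‖sideLine m c θ j t - sideLine m c θ k t'‖ := by
  have h1 := inner_unitVec_sideLine_sub_le hm c θ hj hk hjk hs ht'
  have h2 := inner_unitVec_sideLine_sub m c θ j j t
  rw [sub_self, Real.cos_zero, Real.sin_zero] at h2
  have h3 := real_inner_le_norm (unitVec (sideAngle m θ j))
    (sideLine m c θ j t - sideLine m c θ k t')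
  rw [norm_unitVec, one_mul, ← sub_sub_sub_cancel_right _ _ c, inner_sub_right] at h3
  rw [← sub_sub_sub_cancel_right (sideLine m c θ j t) _ c]
  linarith

/-! ### The distortion of the uniform distribution on the polygon -/

theorem hausdorffMeasure_polygonBoundary {m : ℕ} (hm : 3 ≤ m) (c : EuclideanSpace ℝ (Fin 2))
    (θ : ℝ) :
    Measure.hausdorffMeasure 1 (polygonBoundary m c θ)
      = ENNReal.ofReal (2 * m * Real.sin (Real.pi / m)) := by
  set h := Real.sin (Real.pi / m) with hh
  have hpos : 0 < h := sin_pi_div_pos hm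
  have hlen : (m : ℝ≥0∞) * ENNReal.ofReal (h - -h) = ENNReal.ofReal (2 * m * h) := by
    rw [← ENNReal.ofReal_natCast, ← ENNReal.ofReal_mul (by positivity)]
    congr 1; ring
  rw [polygonBoundary_eq_biUnion_image hm, ← hh, ← hlen]
  -- the sides may share vertices, but without their end points they are disjoint
  refine le_antisymm ?_ ?_
  · refine (measure_biUnion_finset_le _ _).trans_eq ?_
    simp only [(isometry_sideLine m c θ _).hausdorffMeasure_image (Or.inl zero_le_one),
      hausdorffMeasure_real, Real.volume_Icc, Finset.sum_const, Finset.card_range, nsmul_eq_mul]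
  · calc (m : ℝ≥0∞) * ENNReal.ofReal (h - -h)
        = ∑ j ∈ Finset.range m,
            Measure.hausdorffMeasure 1 (sideLine m c θ j '' Set.Ioo (-h) h) := by
          simp only [(isometry_sideLine m c θ _).hausdorffMeasure_image (Or.inl zero_le_one),
            hausdorffMeasure_real, Real.volume_Ioo, Finset.sum_const, Finset.card_range,
            nsmul_eq_mul]
      _ = Measure.hausdorffMeasure 1
            (⋃ j ∈ Finset.range m, sideLine m c θ j '' Set.Ioo (-h) h) := by
          refine (measure_biUnion_finset ?_ fun j _ => ?_).symm
          · intro j hj k hk hjk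
            rw [Function.onFun, Set.disjoint_left]
            rintro _ ⟨t, -, rfl⟩ ⟨t', ht', he⟩
            have hlt : |t'| < h := abs_lt.mpr ht'
            have hgap := sideGap_le_norm_sideLine_sub hm c θ (t := t) (Finset.mem_range.mp hj)
              (Finset.mem_range.mp hk) hjk hlt.le ⟨neg_abs_le t', le_abs_self t'⟩
            rw [he, sub_self, norm_zero] at hgap
            exact hgap.not_gt (sideGap_pos hm hlt)
          · exact (isometry_sideLine m c θ j).isClosedEmbedding.measurableEmbedding
              |>.measurableSet_image.mpr measurableSet_Ioo
      _ ≤ _ := measure_mono (Set.iUnion₂_mono fun j _ => Set.image_mono Set.Ioo_subset_Icc_self)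

theorem distortion_polygonUniform {m : ℕ} (hm : 3 ≤ m) (c : EuclideanSpace ℝ (Fin 2)) (θ : ℝ)
    (α : Finset (EuclideanSpace ℝ (Fin 2))) :
    distortion (polygonUniform m c θ) α = (ENNReal.ofReal (2 * m * Real.sin (Real.pi / m)))⁻¹ *
      ∫⁻ x in polygonBoundary m c θ, ⨅ a ∈ α, ENNReal.ofReal (‖x - a‖ ^ 2)
        ∂(Measure.hausdorffMeasure 1) := by
  rw [distortion, polygonUniform, ProbabilityTheory.cond, lintegral_smul_measure, smul_eq_mul,
    hausdorffMeasure_polygonBoundary hm]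

/-- Placing `k` equally spaced points on each side. -/
theorem quantizationError_polygonUniform_le {m : ℕ} (hm : 3 ≤ m) (c : EuclideanSpace ℝ (Fin 2))
    (θ : ℝ) {n k : ℕ} (hk : 0 < k) (hkn : m * k ≤ n) :
    quantizationError (polygonUniform m c θ) n
      ≤ ENNReal.ofReal (Real.sin (Real.pi / m) ^ 2 / (3 * k ^ 2)) := by
  classical
  set h := Real.sin (Real.pi / m) with hh
  have hpos : 0 < h := sin_pi_div_pos hm
  have hm0 : (0 : ℝ) < m := by exact_mod_cast (by omega : 0 < m)
  have hk0 : (0 : ℝ) < k := by exact_mod_cast hk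
  let τ : ℕ → ℝ := fun i => -h + (2 * i + 1) * h / k
  let α : Finset (EuclideanSpace ℝ (Fin 2)) :=
    (Finset.range m ×ˢ Finset.range k).image fun q => sideLine m c θ q.1 (τ q.2)
  have hα : 1 ≤ α.card ∧ α.card ≤ n := by
    constructor
    · refine Finset.card_pos.mpr (Finset.Nonempty.image ⟨(0, 0), ?_⟩ _)
      simp only [Finset.mem_product, Finset.mem_range]
      omega
    · refine Finset.card_image_le.trans ?_
      rwa [Finset.card_product, Finset.card_range, Finset.card_range]
  refine (iInf₂_le α hα).trans ?_
  rw [distortion_polygonUniform hm, polygonBoundary_eq_biUnion_image hm]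
  have hint : ∫⁻ x in ⋃ j ∈ Finset.range m, sideLine m c θ j '' Set.Icc (-h) h,
      ⨅ a ∈ α, ENNReal.ofReal (‖x - a‖ ^ 2) ∂(Measure.hausdorffMeasure 1)
      ≤ ENNReal.ofReal (m * (2 / 3 * h ^ 3 / k ^ 2)) := by
    refine (lintegral_biUnion_finset_le _ _ _ _).trans ?_
    rw [ENNReal.ofReal_mul hm0.le, ENNReal.ofReal_natCast, ← nsmul_eq_mul]
    conv_rhs => rw [← Finset.card_range m]
    refine Finset.sum_le_card_nsmul _ _ _ fun j hj => ?_
    rw [(isometry_sideLine m c θ j).setLIntegral_hausdorffMeasure_image]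
    refine (lintegral_mono fun t => ?_).trans (lintegral_iInf_midpoints_le h hpos.le k hk)
    refine le_iInf₂ fun i hi => ?_
    refine (iInf₂_le (sideLine m c θ j (τ i))
      (Finset.mem_image.mpr ⟨(j, i), Finset.mk_mem_product hj hi, rfl⟩)).trans_eq ?_
    rw [← dist_eq_norm, (isometry_sideLine m c θ j).dist_eq, Real.dist_eq, sq_abs]
  refine (mul_le_mul_right hint _).trans_eq ?_
  rw [← hh, ← ENNReal.ofReal_inv_of_pos (by positivity), ← ENNReal.ofReal_mul (by positivity)]
  congr 1
  field_simp

/-- The lower bound obtained from the sides trimmed to `|t| ≤ s`. The radius `R = s m / n`, half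
the length of a cell when `n` cells cover the trimmed sides, makes the bound optimal. -/
theorem le_quantizationError_polygonUniform {m : ℕ} (hm : 3 ≤ m) (c : EuclideanSpace ℝ (Fin 2))
    (θ : ℝ) {s : ℝ} (hs0 : 0 ≤ s) (hs : s < Real.sin (Real.pi / m)) {n : ℕ} (hn : 0 < n)
    (hgap : 2 * (s * m / n) ≤ sideGap m s) :
    ENNReal.ofReal (s ^ 3 * m ^ 2 / (3 * Real.sin (Real.pi / m) * n ^ 2))
      ≤ quantizationError (polygonUniform m c θ) n := by
  set h := Real.sin (Real.pi / m) with hh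
  have hpos : 0 < h := sin_pi_div_pos hm
  have hm0 : (0 : ℝ) < m := by exact_mod_cast (by omega : 0 < m)
  have hn0 : (0 : ℝ) < n := by exact_mod_cast hn
  refine le_iInf₂ fun α hα => ?_
  set R := s * m / n with hR
  have hR0 : 0 ≤ R := by positivity
  have hsep : ∀ j ∈ Finset.range m, ∀ k ∈ Finset.range m, j ≠ k →
      ∀ t ∈ Set.Icc (-s) s, ∀ t' ∈ Set.Icc (-s) s,
      2 * R ≤ ‖(sideMidpoint m c θ j + t • sideDirection m θ j)
        - (sideMidpoint m c θ k + t' • sideDirection m θ k)‖ :=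
    fun j hj k hk hjk t _ t' ht' => hgap.trans (sideGap_le_norm_sideLine_sub hm c θ
      (Finset.mem_range.mp hj) (Finset.mem_range.mp hk) hjk hs.le ht')
  have hmain := card_mul_volume_mul_le_sum_setLIntegral_add (Finset.range m) (sideMidpoint m c θ)
    (sideDirection m θ) (fun _ _ => norm_unitVec _) (Set.Icc (-s) s) measurableSet_Icc R hR0 hsep
    α (Finset.card_pos.mp hα.1)
  rw [distortion_polygonUniform hm, ← hh]
  set I := ∫⁻ x in polygonBoundary m c θ, ⨅ a ∈ α, ENNReal.ofReal (‖x - a‖ ^ 2)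
    ∂(Measure.hausdorffMeasure 1) with hI
  have htrim : (∑ j ∈ Finset.range m, ∫⁻ t in Set.Icc (-s) s, ⨅ a ∈ α,
      ENNReal.ofReal (‖sideMidpoint m c θ j + t • sideDirection m θ j - a‖ ^ 2)) ≤ I := by
    calc _ = ∑ j ∈ Finset.range m, ∫⁻ x in sideLine m c θ j '' Set.Icc (-s) s,
          ⨅ a ∈ α, ENNReal.ofReal (‖x - a‖ ^ 2) ∂(Measure.hausdorffMeasure 1) :=
          Finset.sum_congr rfl fun j _ =>
            ((isometry_sideLine m c θ j).setLIntegral_hausdorffMeasure_image _ _).symm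
      _ = ∫⁻ x in ⋃ j ∈ Finset.range m, sideLine m c θ j '' Set.Icc (-s) s,
          ⨅ a ∈ α, ENNReal.ofReal (‖x - a‖ ^ 2) ∂(Measure.hausdorffMeasure 1) := by
          refine (lintegral_biUnion_finset ?_ (fun j _ => ?_) _).symm
          · intro j hj k hk hjk
            rw [Function.onFun, Set.disjoint_left]
            rintro _ ⟨t, -, rfl⟩ ⟨t', ht', he⟩
            have hle := sideGap_le_norm_sideLine_sub hm c θ (t := t) (Finset.mem_range.mp hj)
              (Finset.mem_range.mp hk) hjk hs.le ht'
            rw [he, sub_self, norm_zero] at hle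
            exact hle.not_gt (sideGap_pos hm hs)
          · exact (isometry_sideLine m c θ j).isClosedEmbedding.measurableEmbedding
              |>.measurableSet_image.mpr measurableSet_Icc
      _ ≤ I := by
          rw [hI, polygonBoundary_eq_biUnion_image hm]
          exact lintegral_mono_set (Set.iUnion₂_mono fun j _ =>
            Set.image_mono (Set.Icc_subset_Icc (neg_le_neg hs.le) hs.le))
  have hbound : ENNReal.ofReal (2 / 3 * s ^ 3 * m ^ 3 / n ^ 2) ≤ I := by
    have e : 2 / 3 * s ^ 3 * m ^ 3 / n ^ 2
        = m * (R ^ 2 * (s - -s)) - n * (4 / 3 * R ^ 3) := by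
      rw [hR]; field_simp; ring
    rw [e, ENNReal.ofReal_sub _ (by positivity), tsub_le_iff_right,
      ENNReal.ofReal_mul hm0.le, ENNReal.ofReal_mul (sq_nonneg R), ENNReal.ofReal_mul hn0.le,
      ENNReal.ofReal_natCast, ENNReal.ofReal_natCast, ← Real.volume_Icc]
    rw [Finset.card_range] at hmain
    refine hmain.trans (add_le_add htrim ?_)
    gcongr
    exact hα.2
  refine le_trans (le_of_eq ?_) (mul_le_mul_right hbound _)
  rw [← ENNReal.ofReal_inv_of_pos (by positivity), ← ENNReal.ofReal_mul (by positivity)]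
  congr 1
  field_simp

/-! ### The limit -/

theorem mainTheorem1 (m : ℕ) (hm : 3 ≤ m) (c : EuclideanSpace ℝ (Fin 2)) (θ : ℝ) :
    0 < (1 / 3 : ℝ) * (m : ℝ) ^ 2 * Real.sin (Real.pi / m) ^ 2 ∧
    Tendsto (fun n : ℕ => (n : ℝ≥0∞) ^ 2 * quantizationError (polygonUniform m c θ) n) atTop
      (𝓝 (ENNReal.ofReal ((1 / 3 : ℝ) * (m : ℝ) ^ 2 * Real.sin (Real.pi / m) ^ 2))) := by
  have hpos : 0 < Real.sin (Real.pi / m) := sin_pi_div_pos hm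
  have hm0 : (0 : ℝ) < m := by exact_mod_cast (by omega : 0 < m)
  refine ⟨by positivity, tendsto_order.2 ⟨fun b hb => ?_, fun b hb => ?_⟩⟩
  · -- trim the sides so little that the lower bound still exceeds `b`
    obtain ⟨s, hbs, hs0, hs⟩ : ∃ s, b < ENNReal.ofReal
        (s ^ 3 * m ^ 2 / (3 * Real.sin (Real.pi / m))) ∧ 0 < s ∧ s < Real.sin (Real.pi / m) := by
      have hcont : Tendsto
          (fun s : ℝ => ENNReal.ofReal (s ^ 3 * m ^ 2 / (3 * Real.sin (Real.pi / m))))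
          (𝓝[<] Real.sin (Real.pi / m))
          (𝓝 (ENNReal.ofReal ((1 / 3 : ℝ) * (m : ℝ) ^ 2 * Real.sin (Real.pi / m) ^ 2))) := by
        have e : (1 / 3 : ℝ) * (m : ℝ) ^ 2 * Real.sin (Real.pi / m) ^ 2
            = Real.sin (Real.pi / m) ^ 3 * m ^ 2 / (3 * Real.sin (Real.pi / m)) := by
          field_simp
        rw [e]
        exact (ENNReal.continuous_ofReal.comp (by fun_prop :
          Continuous fun s : ℝ => s ^ 3 * m ^ 2 / (3 * Real.sin (Real.pi / m)))).continuousAt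
            |>.tendsto.mono_left nhdsWithin_le_nhds
      exact ((hcont.eventually_const_lt hb).and (Ioo_mem_nhdsLT hpos)).exists
    have hsmall : ∀ᶠ n : ℕ in atTop, 2 * (s * m / n) < sideGap m s := by
      have h0 : Tendsto (fun n : ℕ => 2 * (s * m / n)) atTop (𝓝 (2 * 0)) :=
        (tendsto_const_div_atTop_nhds_zero_nat _).const_mul 2
      rw [mul_zero] at h0
      exact h0.eventually_lt_const (sideGap_pos hm hs)
    filter_upwards [hsmall, eventually_gt_atTop 0] with n hn hn0
    have hn0' : (0 : ℝ) < n := by exact_mod_cast hn0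
    refine hbs.trans_le (le_trans (le_of_eq ?_)
      (mul_le_mul_right (le_quantizationError_polygonUniform hm c θ hs0.le hs hn0 hn.le) _))
    rw [← ENNReal.ofReal_natCast, ← ENNReal.ofReal_pow hn0'.le,
      ← ENNReal.ofReal_mul (by positivity)]
    congr 1
    field_simp
  · have hk : Tendsto (fun n : ℕ => n / m) atTop atTop := Nat.tendsto_div_const_atTop (by omega)
    have hlim : Tendsto (fun n : ℕ => ENNReal.ofReal ((1 / 3 : ℝ) * (m : ℝ) ^ 2 *
        Real.sin (Real.pi / m) ^ 2 * (1 + 1 / ((n / m : ℕ) : ℝ)) ^ 2)) atTop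
        (𝓝 (ENNReal.ofReal ((1 / 3 : ℝ) * (m : ℝ) ^ 2 * Real.sin (Real.pi / m) ^ 2))) := by
      refine ENNReal.tendsto_ofReal ?_
      have h0 := (((tendsto_one_div_atTop_nhds_zero_nat (𝕜 := ℝ)).comp hk).const_add 1).pow 2
        |>.const_mul ((1 / 3 : ℝ) * (m : ℝ) ^ 2 * Real.sin (Real.pi / m) ^ 2)
      simpa using h0
    filter_upwards [hlim.eventually_lt_const hb, hk.eventually_gt_atTop 0] with n hn hk0
    refine lt_of_le_of_lt ?_ hn
    have hk0' : (0 : ℝ) < ((n / m : ℕ) : ℝ) := by exact_mod_cast hk0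
    have hnk : (n : ℝ) ≤ m * (((n / m : ℕ) : ℝ) + 1) := by
      exact_mod_cast (Nat.lt_mul_div_succ n (by omega : 0 < m)).le
    refine (mul_le_mul_right (quantizationError_polygonUniform_le hm c θ hk0
      (Nat.mul_div_le n m)) _).trans ?_
    rw [← ENNReal.ofReal_natCast, ← ENNReal.ofReal_pow (Nat.cast_nonneg n),
      ← ENNReal.ofReal_mul (by positivity)]
    refine ENNReal.ofReal_le_ofReal ?_
    calc (n : ℝ) ^ 2 * (Real.sin (Real.pi / m) ^ 2 / (3 * ((n / m : ℕ) : ℝ) ^ 2))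
        ≤ (m * (((n / m : ℕ) : ℝ) + 1)) ^ 2
            * (Real.sin (Real.pi / m) ^ 2 / (3 * ((n / m : ℕ) : ℝ) ^ 2)) := by gcongr
      _ = _ := by field_simp
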